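/- Let $m\ge 1$ be an integer. For $x\in L_2(\mathbf R)$ (complex valued) let $X(i\omega)=\int_{\mathbf R}e^{-i\omega t}x(t)\,dt$ be its Fourier transform, an element of $L_2(\mathbf R)$ as a function of $\omega$. Let $\mathcal I_f$ be the set of Borel subsets of $\mathbf R$ of positive finite Lebesgue measure, $\mathcal I_\infty$ the set of Borel subsets of $\mathbf R$ that contain $(a,+\infty)$ or $(-\infty,a)$ for some $a\in\mathbf R$, and $\mathcal I=\mathcal I_f\cup\mathcal I_\infty$. Let $\mathcal T=(\Gamma,I,h)$, where $\Gamma$ is a set of ordered pairs $(d,k)$ with $d,k\in\{1,\dots,m\}$, $d\ne k$, such that $(d,k)\in\Gamma$ implies $(k,d)\notin\Gamma$, and where to each $(d,k)\in\Gamma$ are assigned a set $I_{d,k}\in\mathcal I$ and a continuous (not necessarily linear) map $h_{d,k}:L_2(\mathbf R)\to L_2(\mathbf R)$. A $\mathcal T$-branched process is a tuple $(x_1,\dots,x_m)\in L_2(\mathbf R)^m$ such that $x_k=h_{d,k}(x_d)$ a.e. on $I_{d,k}$ for all $(d,k)\in\Gamma$. Let $G=(G_1,\dots,G_m)$, where $G_d\in\mathcal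 I$ for $d\ge 2$, and $G_1=\emptyset$ or $G_1\in\mathcal I$, and let $\mathcal L^G_{2,\mathcal T}$ be the set of $\mathcal T$-branched processes such that, for every $d$, $X_d(i\omega)=0$ for a.e. $\omega\in G_d$. Suppose that for every $d\in\{2,\dots,m\}$ there are $j\ge 0$ and a chain $1=d_0,d_1,\dots,d_j,d_{j+1}=d$ in $\{1,\dots,m\}$ such that, for every $k=1,\dots,j+1$, $$(d_{k-1},d_k)\in\Gamma\quad\text{and}\quad \mathrm{mes}\,(I_{d_{k-1},d_k}\cup G_{d_k})=+\infty .$$ Let $(x_d)_{d=1}^m$ and $(y_d)_{d=1}^m$ belong to $\mathcal L^G_{2,\mathcal T}$. Then: (i) if $x_1=y_1$ in $L_2(\mathbf R)$, then $x_d=y_d$ in $L_2(\mathbf R)$ for all $d$; (ii) if $G_1\in\mathcal I$, $\bar I\in\mathcal I_\infty$, and $x_1=y_1$ a.e. on $\bar I$, then $x_d=y_d$ in $L_2(\mathbf R)$ for all $d$; (iii) if $G_1\in\mathcal I_\infty$, $\bar I\in\mathcal I$, and $x_1=y_1$ a.e. on $\bar I$, then $x_d=y_d$ in $L_2(\mathbf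 R)$ for all $d$. -/

import Mathlib

open MeasureTheory Set
open scoped FourierTransform

noncomputable section

namespace Branched

/-- The complex space `L₂(ℝ)` (Lebesgue measure; classes of a.e. equal functions). -/
abbrev L2 : Type := Lp ℂ 2 (volume : Measure ℝ)

/-- The Fourier transform of `x ∈ L₂(ℝ)` in angular frequency,
`X(iω) = ∫ e^{-iωt} x(t) dt`, as a function of `ω` that is determined up to a null set.
Mathlib's `𝓕` on `L₂(ℝ)` is the continuous extension of `ξ ↦ ∫ e^{-2πiξt} x(t) dt`,
so that `X(iω) = (𝓕 x)(ω / (2π))`. -/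
def angFourier (x : L2) (ω : ℝ) : ℂ := (𝓕 x : L2) (ω / (2 * Real.pi))

/-- Borel subsets of `ℝ` of positive finite measure. -/
def IFin : Set (Set ℝ) := {B | MeasurableSet B ∧ 0 < volume B ∧ volume B < ⊤}

/-- Borel subsets of `ℝ` that contain a half-line. -/
def IInf : Set (Set ℝ) := {B | MeasurableSet B ∧ ∃ a : ℝ, Ioi a ⊆ B ∨ Iio a ⊆ B}

/-- The class `𝓘 = 𝓘_f ∪ 𝓘_∞`. -/
def IAll : Set (Set ℝ) := IFin ∪ IInf

/-- A triplet `𝒯 = (Γ, I, h)` on the `m` branches indexed by `Fin m`: a set `Γ` of ordered pairs of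
distinct branches containing no pair together with its reverse; for each `(d, k) ∈ Γ`
a set `I_{d,k} ∈ 𝓘` and a continuous, not necessarily linear, map `h_{d,k} : L₂(ℝ) → L₂(ℝ)`. -/
structure Triplet (m : ℕ) where
  Γ : Set (Fin m × Fin m)
  ne_of_mem : ∀ d k, (d, k) ∈ Γ → d ≠ k
  asymm : ∀ d k, (d, k) ∈ Γ → (k, d) ∉ Γ
  I : Γ → Set ℝ
  I_mem : ∀ e, I e ∈ IAll
  h : Γ → L2 → L2
  continuous_h : ∀ e, Continuous (h e)

variable {m : ℕ}

/-- The set `𝓛_{2,𝒯}` of `𝒯`-branched processes: tuples in `L₂(ℝ)^m` such that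
`x_k = h_{d,k}(x_d)` a.e. on `I_{d,k}` for all `(d, k) ∈ Γ`. -/
def Triplet.processes (T : Triplet m) : Set (Fin m → L2) :=
  {x | ∀ (d k : Fin m) (e : (d, k) ∈ T.Γ),
    ∀ᵐ t : ℝ, t ∈ T.I ⟨(d, k), e⟩ → (x k) t = (T.h ⟨(d, k), e⟩ (x d)) t}

/-- The set `𝓛^G_{2,𝒯}` of those `𝒯`-branched processes for which `X_d(iω) = 0`
for almost every `ω ∈ G_d`, for all `d`. -/
def Triplet.gapProcesses (T : Triplet m) (G : Fin m → Set ℝ) : Set (Fin m → L2) :=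
  {x | x ∈ T.processes ∧ ∀ d : Fin m, ∀ᵐ ω : ℝ, ω ∈ G d → angFourier (x d) ω = 0}

/-- There is a chain `a = d_0, d_1, …, d_j, d_{j+1} = b` with `(d_{k-1}, d_k) ∈ Γ` and
`mes (I_{d_{k-1},d_k} ∪ G_{d_k}) = +∞` for `k = 1, …, j+1` (here `j ≥ 0`; the values of `c`
beyond `j + 1` are irrelevant). -/
def Triplet.Reaches (T : Triplet m) (G : Fin m → Set ℝ) (a b : Fin m) : Prop :=
  ∃ (j : ℕ) (c : ℕ → Fin m), c 0 = a ∧ c (j + 1) = b ∧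
    ∀ k ∈ Finset.Icc 1 (j + 1), ∃ e : (c (k - 1), c k) ∈ T.Γ,
      volume (T.I ⟨(c (k - 1), c k), e⟩ ∪ G (c k)) = ⊤

end Branched

end

/-!
The heart of the matter is a uniqueness property of one-sided functions. If `z ∈ L₂(ℝ)` vanishes
on a half-line and its Fourier transform `Z` vanishes on a set of positive measure, then `z = 0`;
likewise with the roles of `z` and `Z` exchanged. Along each edge `(d, k)` of a chain, the
difference of two processes vanishes on `I_{d,k}` and its spectrum vanishes on `G_k`, as soon as the
processes agree on branch `d`. One of the two sets contains a half-line, since their union has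
infinite measure, so the processes agree on branch `k` (`eq_of_eq_on_of_angFourier_eq_zero`). The
same step applied to `J` and the gap of the first branch gives the agreement on the first branch in
the last two assertions.

The uniqueness property holds because `Z` belongs to the Hardy space of a half-plane, and it is
proved without analytic continuation or boundary values. By Plancherel, `Z` is orthogonal to the
Fourier transforms of the functions `sⁿ e⁻ˢ` on the half-line, which are powers of the Cauchy kernel
`u(ξ) = 1 / (1 - icξ)` (`fourier_moments`). In terms of the Cayley map `b = 2u - 1`, a bijection of
the line onto the circle without a point, this says that the integrable function `F = Z u` satisfies
`∫ F bᵏ = 0` for `k ≥ 0`. What remains is the uniqueness theorem of F. and M. Riesz: if `∫ F bᵏ = 0`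
for `k > 0` and `F = 0` on a set `K` of positive measure, then `∫ F = 0`
(`integral_eq_zero_of_vanishing`). Indeed `∫ F exp(n P(b)) = exp(n P(0)) ∫ F` for polynomials `P`;
when `Re P(b)` approximates the indicator of `K`, the left side stays bounded by about `∫ |F|` for
each `n`, while `Re P(0)`, the mean of `Re P`, stays positive, and `n → ∞` gives the claim. Applied
to `F b⁻¹, F b⁻², …` in turn, it shows that all moments of `F` vanish, so that `F = 0`.
-/

namespace HardyUniqueness

open Filter Topology Branched SchwartzMap

/-! ### The Fourier transform of one-sided functions -/

theorem ae_eq_of_forall_schwartz {f g : ℝ → ℂ} (hf : LocallyIntegrable f) (hg : LocallyIntegrable g)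
    (h : ∀ ψ : 𝓢(ℝ, ℂ), ∫ x, ψ x • f x = ∫ x, ψ x • g x) : f =ᵐ[volume] g := by
  refine ae_eq_of_integral_contDiff_smul_eq hf hg fun φ hφ hφs => ?_
  have hφ' : ContDiff ℝ (⊤ : ℕ∞) (fun x => (φ x : ℂ)) := Complex.ofRealCLM.contDiff.comp hφ
  have hφs' : HasCompactSupport (fun x => (φ x : ℂ)) := hφs.comp_left (g := ((↑) : ℝ → ℂ)) rfl
  exact h (hφs'.toSchwartzMap hφ')

/-- The Fourier transform of `L₂` agrees with the Fourier integral on integrable functions, since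
both are adjoint to the Fourier transform of test functions. -/
theorem fourier_ae_eq {z : L2} (hz : Integrable z) :
    ((𝓕 z : L2) : ℝ → ℂ) =ᵐ[volume] 𝓕 (z : ℝ → ℂ) := by
  have hc : Continuous (𝓕 (z : ℝ → ℂ)) :=
    VectorFourier.fourierIntegral_continuous Real.continuous_fourierChar (by fun_prop) hz
  refine ae_eq_of_forall_schwartz ((Lp.memLp _).locallyIntegrable (by norm_num))
    hc.locallyIntegrable fun ψ => ?_
  have h := congrArg (fun T => T ψ) (Lp.fourier_toTemperedDistribution_eq z)
  simp only [TemperedDistribution.fourier_apply, Lp.toTemperedDistribution_apply] at h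
  have h2 := VectorFourier.integral_fourierIntegral_smul_eq_flip (μ := volume) (ν := volume)
    (L := innerₗ ℝ) Real.continuous_fourierChar (by fun_prop) (ψ.integrable) hz
  rw [flip_innerₗ] at h2
  exact h.symm.trans h2

/-- The inverse Fourier transform of `L₂` agrees with the inverse Fourier integral on integrable
functions. -/
theorem fourierInv_ae_eq {z : L2} (hz : Integrable z) :
    ((𝓕⁻ z : L2) : ℝ → ℂ) =ᵐ[volume] 𝓕⁻ (z : ℝ → ℂ) := by
  have hc : Continuous (𝓕⁻ (z : ℝ → ℂ)) :=
    VectorFourier.fourierIntegral_continuous (L := -innerₗ ℝ) Real.continuous_fourierChar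
      (by simp only [LinearMap.neg_apply]; fun_prop) hz
  refine ae_eq_of_forall_schwartz ((Lp.memLp _).locallyIntegrable (by norm_num))
    hc.locallyIntegrable fun ψ => ?_
  have h := congrArg (fun T => T ψ) (Lp.fourierInv_toTemperedDistribution_eq z)
  simp only [TemperedDistribution.fourierInv_apply, Lp.toTemperedDistribution_apply] at h
  have h2 := VectorFourier.integral_fourierIntegral_smul_eq_flip (μ := volume) (ν := volume)
    (L := -innerₗ ℝ) Real.continuous_fourierChar (by simp only [LinearMap.neg_apply]; fun_prop)
      (ψ.integrable) hz
  have h3 : (-innerₗ ℝ).flip = -innerₗ ℝ := by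
    ext
    simp
  rw [h3] at h2
  have h4 (f : ℝ → ℂ) : VectorFourier.fourierIntegral Real.fourierChar volume (-innerₗ ℝ) f =
      𝓕⁻ f := by
    ext ξ
    simp [VectorFourier.fourierIntegral, Real.fourierInv_eq]
  rw [h4, h4, ← fourierInv_coe] at h2
  exact h.symm.trans h2

theorem integrableOn_pow_mul_exp_neg (n : ℕ) :
    IntegrableOn (fun s : ℝ => s ^ n * Real.exp (-s)) (Ioi 0) := by
  have h := Real.GammaIntegral_convergent (s := n + 1) (by positivity)
  refine h.congr_fun (fun s _ => ?_) measurableSet_Ioi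
  simp [mul_comm]

theorem integrableOn_pow_mul_exp_mul (n : ℕ) (c : ℝ) :
    IntegrableOn (fun s : ℝ => (s : ℂ) ^ n * Complex.exp (-(1 - c * Complex.I) * s)) (Ioi 0) := by
  refine (integrableOn_pow_mul_exp_neg n).mono' (by fun_prop) ?_
  filter_upwards [ae_restrict_mem measurableSet_Ioi] with s hs
  simp [Complex.norm_exp, abs_of_pos (mem_Ioi.1 hs)]

theorem one_sub_mul_I_ne_zero (c : ℝ) : (1 - c * Complex.I : ℂ) ≠ 0 := fun h => by
  simpa using congrArg Complex.re h

theorem tendsto_pow_mul_exp_mul (n : ℕ) (c : ℝ) :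
    Filter.Tendsto (fun s : ℝ => (s : ℂ) ^ n * Complex.exp (-(1 - c * Complex.I) * s))
      Filter.atTop (nhds 0) := by
  rw [tendsto_zero_iff_norm_tendsto_zero]
  refine (Real.tendsto_pow_mul_exp_neg_atTop_nhds_zero n).congr' ?_
  filter_upwards [Filter.eventually_gt_atTop 0] with s hs
  simp [Complex.norm_exp, abs_of_pos hs]

theorem integral_pow_mul_exp_mul (n : ℕ) (c : ℝ) :
    ∫ s in Ioi (0 : ℝ), (s : ℂ) ^ n * Complex.exp (-(1 - c * Complex.I) * s) =
      n.factorial / (1 - c * Complex.I) ^ (n + 1) := by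
  have hr := one_sub_mul_I_ne_zero c
  set r : ℂ := 1 - c * Complex.I with hrdef
  have hexp (s : ℝ) : HasDerivAt (fun s : ℝ => Complex.exp (-r * s))
      (Complex.exp (-r * s) * (-r * 1)) s :=
    ((Complex.ofRealCLM.hasDerivAt (x := s)).const_mul (-r)).cexp
  induction n with
  | zero =>
    have h := integral_Ioi_of_hasDerivAt_of_tendsto' (a := (0 : ℝ))
      (fun s _ => (hexp s).div_const (-r)) (m := 0 / (-r)) ?_
      (by
        have := (tendsto_pow_mul_exp_mul 0 c).div_const (-r)
        rw [← hrdef] at this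
        simpa only [pow_zero, one_mul] using this)
    · simpa [hr, mul_div_assoc, neg_div] using h
    · refine (integrableOn_pow_mul_exp_mul 0 c).congr_fun (fun s _ => ?_) measurableSet_Ioi
      simp [← hrdef, hr]
  | succ n ih =>
    have hd (s : ℝ) : HasDerivAt (fun s : ℝ => (s : ℂ) ^ (n + 1) * Complex.exp (-r * s))
        ((n + 1) * ((s : ℂ) ^ n * Complex.exp (-r * s)) -
          r * ((s : ℂ) ^ (n + 1) * Complex.exp (-r * s))) s := by
      convert! ((Complex.ofRealCLM.hasDerivAt (x := s)).pow (n + 1)).mul (hexp s) using 1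
      simp
      ring
    have i1 := (integrableOn_pow_mul_exp_mul n c).const_mul (n + 1 : ℂ)
    have i2 := (integrableOn_pow_mul_exp_mul (n + 1) c).const_mul r
    have h := integral_Ioi_of_hasDerivAt_of_tendsto' (a := (0 : ℝ)) (fun s _ => hd s)
      (i1.sub i2) (tendsto_pow_mul_exp_mul (n + 1) c)
    rw [integral_sub i1 i2, integral_const_mul, integral_const_mul, ih] at h
    have h' := sub_eq_zero.1 (h.trans (by simp))
    rw [eq_div_iff (pow_ne_zero _ hr)]
    have e : r ^ (n + 1 + 1) = r * r ^ (n + 1) := by ring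
    rw [e, ← mul_assoc, mul_comm _ r, ← h', Nat.factorial_succ]
    field_simp
    push_cast
    ring

/-- The function `sⁿ e⁻ˢ` of `s = ε (t - a)` for `s > 0`, extended by zero. For `ε = 1` it is
supported on the half-line to the right of `a`, for `ε = -1` on the one to the left. -/
noncomputable def laguerreFun (ε a : ℝ) (n : ℕ) (t : ℝ) : ℂ :=
  indicator (Ioi 0) (fun s : ℝ => ((s ^ n * Real.exp (-s) : ℝ) : ℂ)) (ε * (t - a))

theorem integral_comp_sign_mul_sub {ε : ℝ} (hε : |ε| = 1) (a : ℝ) (g : ℝ → ℂ) :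
    ∫ t, g (ε * (t - a)) = ∫ s, g s := by
  rw [integral_sub_right_eq_self (fun t => g (ε * t)), Measure.integral_comp_mul_left]
  simp [abs_inv, hε]

theorem integrable_comp_sign_mul_sub {ε : ℝ} (hε : |ε| = 1) (a : ℝ) {E : Type*}
    [NormedAddCommGroup E] {g : ℝ → E}
    (hg : Integrable g) : Integrable (fun t => g (ε * (t - a))) := by
  have : ε ≠ 0 := by rintro rfl; simp at hε
  exact (hg.comp_mul_left' this).comp_sub_right a

theorem integrable_laguerreFun {ε : ℝ} (hε : |ε| = 1) (a : ℝ) (n : ℕ) :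
    Integrable (laguerreFun ε a n) := by
  refine integrable_comp_sign_mul_sub hε a ?_
  rw [integrable_indicator_iff measurableSet_Ioi]
  exact (integrableOn_pow_mul_exp_neg n).ofReal

theorem memLp_laguerreFun {ε : ℝ} (hε : |ε| = 1) (a : ℝ) (n : ℕ) :
    MemLp (laguerreFun ε a n) 2 := by
  rw [memLp_two_iff_integrable_sq_norm (integrable_laguerreFun hε a n).aestronglyMeasurable]
  have h : Integrable (indicator (Ioi 0) fun s : ℝ => s ^ (2 * n) * Real.exp (-s)) := by
    rw [integrable_indicator_iff measurableSet_Ioi]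
    exact (integrableOn_pow_mul_exp_neg _)
  refine (integrable_comp_sign_mul_sub hε a h).mono'
    ((integrable_laguerreFun hε a n).aestronglyMeasurable.norm.pow 2) (.of_forall fun t => ?_)
  rw [laguerreFun]
  by_cases ht : ε * (t - a) ∈ Ioi 0
  · rw [indicator_of_mem ht, indicator_of_mem ht]
    have hs : 0 < ε * (t - a) := ht
    generalize ε * (t - a) = s at hs
    have : Real.exp (-s) ≤ 1 := by simpa using hs.le
    rw [Complex.norm_real, norm_pow, norm_norm, Real.norm_of_nonneg (by positivity),
      mul_pow, ← pow_mul, mul_comm n, sq (Real.exp _)]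
    gcongr
    exact mul_le_of_le_one_left (by positivity) this
  · rw [indicator_of_notMem ht, indicator_of_notMem ht]
    simp

/-- The Fourier integrals of `laguerreFun ε a n` are, up to a phase, the `(n + 1)`-st powers of a
Cauchy kernel. -/
theorem integral_exp_mul_laguerreFun {ε : ℝ} (hε : |ε| = 1) (a : ℝ) (n : ℕ) (c : ℝ) :
    ∫ t : ℝ, Complex.exp (c * t * Complex.I) * laguerreFun ε a n t =
      Complex.exp (c * a * Complex.I) *
        (n.factorial / (1 - ((ε * c : ℝ) : ℂ) * Complex.I) ^ (n + 1)) := by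
  have hε2 : ε * ε = 1 := by rw [← abs_mul_abs_self, hε, one_mul]
  rw [← integral_pow_mul_exp_mul, ← integral_indicator measurableSet_Ioi, ← integral_const_mul,
    ← integral_comp_sign_mul_sub hε a (fun s => _ * indicator (Ioi 0) _ s)]
  congr 1 with t
  rw [laguerreFun]
  by_cases ht : ε * (t - a) ∈ Ioi 0
  · rw [indicator_of_mem ht, indicator_of_mem ht]
    rw [mul_left_comm, ← Complex.exp_add]
    push_cast
    rw [mul_left_comm, ← Complex.exp_add]
    congr 2
    have : (ε : ℂ) * ε = 1 := by exact_mod_cast hε2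
    linear_combination -(c * (t - a) * Complex.I) * this
  · rw [indicator_of_notMem ht, indicator_of_notMem ht]
    simp

theorem fourier_laguerreFun {ε : ℝ} (hε : |ε| = 1) (a : ℝ) (n : ℕ) (ξ : ℝ) :
    𝓕 (laguerreFun ε a n) ξ = Complex.exp (((-(2 * Real.pi * ξ) : ℝ) : ℂ) * a * Complex.I) *
        (n.factorial / (1 - ((ε * (-(2 * Real.pi * ξ)) : ℝ) : ℂ) * Complex.I) ^ (n + 1)) := by
  rw [← integral_exp_mul_laguerreFun hε, Real.fourier_eq']
  congr 1 with t
  simp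
  left
  congr 2
  ring

theorem fourierInv_laguerreFun {ε : ℝ} (hε : |ε| = 1) (a : ℝ) (n : ℕ) (ξ : ℝ) :
    𝓕⁻ (laguerreFun ε a n) ξ = Complex.exp (((2 * Real.pi * ξ : ℝ) : ℂ) * a * Complex.I) *
        (n.factorial / (1 - ((ε * (2 * Real.pi * ξ) : ℝ) : ℂ) * Complex.I) ^ (n + 1)) := by
  rw [← integral_exp_mul_laguerreFun hε, Real.fourierInv_eq']
  congr 1 with t
  simp
  left
  congr 2
  ring

/-- Orthogonality to the transform `W` of a function `laguerreFun ε a n`, written as a moment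
condition. The frequency `κ` is `-2π` for the Fourier transform and `2π` for its inverse. -/
theorem integral_mul_div_pow_eq_zero_of_inner {Z W : L2} {ε a κ : ℝ} {n : ℕ}
    (hW : (W : ℝ → ℂ) =ᵐ[volume] fun ξ => Complex.exp (((κ * ξ : ℝ) : ℂ) * a * Complex.I) *
        (n.factorial / (1 - ((ε * (κ * ξ) : ℝ) : ℂ) * Complex.I) ^ (n + 1)))
    (h : inner ℂ W Z = 0) :
    ∫ ξ, Z ξ * Complex.exp (((-(κ * ξ) : ℝ) : ℂ) * a * Complex.I) *
        (1 / (1 - ((-(ε * κ) * ξ : ℝ) : ℂ) * Complex.I)) ^ (n + 1) = 0 := by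
  rw [L2.inner_def] at h
  have hn : (n.factorial : ℂ) ≠ 0 := by exact_mod_cast n.factorial_ne_zero
  rw [← mul_right_inj' hn, mul_zero, ← h, ← integral_const_mul]
  refine integral_congr_ae ?_
  filter_upwards [hW] with ξ hξ
  simp only [RCLike.inner_apply]
  rw [hξ]
  simp [← Complex.exp_conj]
  ring

theorem inner_eq_zero_of_laguerreFun {z v : L2} {ε a : ℝ} {n : ℕ}
    (hz : ∀ᵐ t : ℝ, 0 < ε * (t - a) → z t = 0) (hv : (v : ℝ → ℂ) =ᵐ[volume] laguerreFun ε a n) :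
    inner ℂ v z = 0 := by
  rw [L2.inner_def]
  refine integral_eq_zero_of_ae ?_
  filter_upwards [hz, hv] with t h1 h2
  simp only [RCLike.inner_apply, Pi.zero_apply]
  by_cases ht : 0 < ε * (t - a)
  · simp [h1 ht]
  · rw [h2, laguerreFun, indicator_of_notMem (by simpa using ht)]
    simp

/-- If `z` vanishes on the half-line `{t | 0 < ε (t - a)}`, then by Plancherel `𝓕 z` is orthogonal
to the transforms of the functions `laguerreFun ε a n`, which live on that half-line. -/
theorem fourier_moments {z : L2} {ε a : ℝ} (hε : |ε| = 1)
    (hz : ∀ᵐ t : ℝ, 0 < ε * (t - a) → z t = 0) (n : ℕ) :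
    ∫ ξ, (𝓕 z : L2) ξ * Complex.exp (((-(-(2 * Real.pi) * ξ) : ℝ) : ℂ) * a * Complex.I) *
        (1 / (1 - ((-(ε * (-(2 * Real.pi))) * ξ : ℝ) : ℂ) * Complex.I)) ^ (n + 1) = 0 := by
  have hv := (memLp_laguerreFun hε a n).coeFn_toLp
  have hi : Integrable ((memLp_laguerreFun hε a n).toLp _) :=
    (integrable_laguerreFun hε a n).congr hv.symm
  refine integral_mul_div_pow_eq_zero_of_inner (W := 𝓕 ((memLp_laguerreFun hε a n).toLp _)) ?_
    ((Lp.inner_fourier_eq _ _).trans (inner_eq_zero_of_laguerreFun hz hv))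
  filter_upwards [fourier_ae_eq hi] with ξ hξ
  rw [hξ, Real.fourier_congr_ae hv, fourier_laguerreFun hε]
  simp

theorem fourierInv_moments {z : L2} {ε a : ℝ} (hε : |ε| = 1)
    (hz : ∀ᵐ t : ℝ, 0 < ε * (t - a) → z t = 0) (n : ℕ) :
    ∫ ξ, (𝓕⁻ z : L2) ξ * Complex.exp (((-((2 * Real.pi) * ξ) : ℝ) : ℂ) * a * Complex.I) *
        (1 / (1 - ((-(ε * (2 * Real.pi)) * ξ : ℝ) : ℂ) * Complex.I)) ^ (n + 1) = 0 := by
  have hv := (memLp_laguerreFun hε a n).coeFn_toLp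
  have hi : Integrable ((memLp_laguerreFun hε a n).toLp _) :=
    (integrable_laguerreFun hε a n).congr hv.symm
  refine integral_mul_div_pow_eq_zero_of_inner (W := 𝓕⁻ ((memLp_laguerreFun hε a n).toLp _)) ?_
    (((Lp.fourierTransformₗᵢ ℝ ℂ).symm.inner_map_map _ _).trans
      (inner_eq_zero_of_laguerreFun hz hv))
  filter_upwards [fourierInv_ae_eq hi] with ξ hξ
  rw [hξ, Real.fourierInv_congr_ae hv, fourierInv_laguerreFun hε]

/-! ### Moments of functions on the circle -/

/-- The Laurent polynomials, as functions on the unit circle. -/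
noncomputable def laurentSpan : Submodule ℂ (Circle → ℂ) :=
  Submodule.span ℂ (range fun (n : ℤ) (z : Circle) => (z : ℂ) ^ n)

/-- Density of the Laurent polynomials in the continuous functions on the circle. -/
theorem exists_laurent_near {g : Circle → ℂ} (hg : Continuous g) {ε : ℝ} (hε : 0 < ε) :
    ∃ q ∈ laurentSpan, ∀ z, ‖q z - g z‖ < ε := by
  have : Fact ((0 : ℝ) < 1) := ⟨one_pos⟩
  let e := AddCircle.homeomorphCircle (T := (1 : ℝ)) one_ne_zero
  let g' : C(AddCircle (1 : ℝ), ℂ) := ⟨fun x => g (e x), by fun_prop⟩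
  have hmem : g' ∈ (Submodule.span ℂ (range <| @fourier (1 : ℝ))).topologicalClosure := by
    rw [span_fourier_closure_eq_top]; trivial
  obtain ⟨p, hp, hpg⟩ := Metric.mem_closure_iff.1 hmem ε hε
  refine ⟨fun z => p (e.symm z), ?_, fun z => ?_⟩
  · clear hpg
    induction hp using Submodule.span_induction with
    | mem p hp =>
      obtain ⟨n, rfl⟩ := hp
      refine Submodule.subset_span ⟨n, ?_⟩
      ext z
      obtain ⟨x, rfl⟩ := e.surjective z
      rw [Homeomorph.symm_apply_apply]
      simp [e, AddCircle.homeomorphCircle_apply, AddCircle.toCircle_zsmul]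
    | zero => exact laurentSpan.zero_mem
    | add x y _ _ hx hy => exact laurentSpan.add_mem hx hy
    | smul c x _ hx => exact laurentSpan.smul_mem c hx
  · have := (ContinuousMap.dist_lt_iff hε).1 hpg (e.symm z)
    rw [dist_comm, dist_eq_norm] at this
    simpa [g'] using this

/-- The indicator of a closed subset of the circle is a bounded, everywhere pointwise limit of
Laurent polynomials. -/
theorem exists_laurent_tendsto_indicator {C : Set Circle} (hC : IsClosed C) :
    ∃ q : ℕ → Circle → ℂ, (∀ j, q j ∈ laurentSpan) ∧ (∀ j z, ‖q j z‖ ≤ 2) ∧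
      ∀ z, Tendsto (fun j => q j z) atTop (𝓝 (C.indicator 1 z)) := by
  have hδ (j : ℕ) : (0 : ℝ) < 1 / (j + 1) := Nat.one_div_pos_of_nat
  let g (j : ℕ) (z : Circle) : ℂ := ((thickenedIndicator (hδ j) C z : NNReal) : ℝ)
  have hg (j : ℕ) : Continuous (g j) := by fun_prop
  choose q hq hqg using fun j => exists_laurent_near (hg j) (hδ j)
  have h0 : Tendsto (fun j : ℕ => (1 : ℝ) / (j + 1)) atTop (𝓝 0) :=
    tendsto_one_div_add_atTop_nhds_zero_nat
  refine ⟨q, hq, fun j z => ?_, fun z => ?_⟩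
  · have h1 : ‖g j z‖ ≤ 1 := by
      have := thickenedIndicator_le_one (hδ j) C z
      simpa [g] using this
    have h2 : (1 : ℝ) / (j + 1) ≤ 1 := by
      rw [div_le_one (by positivity)]
      simp
    calc ‖q j z‖ = ‖(q j z - g j z) + g j z‖ := by simp
      _ ≤ ‖q j z - g j z‖ + ‖g j z‖ := norm_add_le _ _
      _ ≤ 2 := by linarith [hqg j z]
  · have h1 : Tendsto (fun j => g j z) atTop (𝓝 (C.indicator 1 z)) := by
      have := (tendsto_pi_nhds.1 (thickenedIndicator_tendsto_indicator_closure hδ h0 C) z)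
      rw [hC.closure_eq] at this
      have h2 := (Complex.continuous_ofReal.tendsto _).comp
        ((NNReal.continuous_coe.tendsto _).comp this)
      convert! h2 using 2
      by_cases hz : z ∈ C <;> simp [hz]
    have h2 : Tendsto (fun j => q j z - g j z) atTop (𝓝 0) :=
      squeeze_zero_norm (fun j => (hqg j z).le) h0
    simpa using h2.add h1

/-- On the circle, the real part of a Laurent polynomial is the real part of a polynomial, because
`z⁻¹` is the conjugate of `z`. -/
theorem exists_polynomial_re_eq {q : Circle → ℂ} (hq : q ∈ laurentSpan) :
    ∃ P : Polynomial ℂ, ∀ z : Circle, (P.eval (z : ℂ)).re = (q z).re := by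
  suffices ∀ c : ℂ, ∃ P : Polynomial ℂ, ∀ z : Circle, (P.eval (z : ℂ)).re = (c * q z).re by
    simpa using this 1
  induction hq using Submodule.span_induction with
  | mem q hq =>
    obtain ⟨n, rfl⟩ := hq
    intro c
    obtain ⟨k, rfl | rfl⟩ := n.eq_nat_or_neg
    · exact ⟨.C c * .X ^ k, fun z => by simp⟩
    · refine ⟨.C ((starRingEnd ℂ) c) * .X ^ k, fun z => ?_⟩
      rw [← Complex.conj_re]
      congr 1
      simp [← Circle.coe_inv_eq_conj]
  | zero => exact fun c => ⟨0, by simp⟩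
  | add x y _ _ hx hy =>
    intro c
    obtain ⟨P, hP⟩ := hx c
    obtain ⟨Q, hQ⟩ := hy c
    exact ⟨P + Q, fun z => by simp [hP, hQ, mul_add]⟩
  | smul d x _ hx =>
    intro c
    obtain ⟨P, hP⟩ := hx (c * d)
    exact ⟨P, fun z => by simp [hP, mul_assoc]⟩

section Moments

variable {X : Type*} [TopologicalSpace X] [MeasurableSpace X] [OpensMeasurableSpace X]
  {μ σ : Measure X} {β : X → Circle} {F : X → ℂ}

theorem integrable_mul_zpow (hβ : Continuous β) (hF : Integrable F μ) (n : ℤ) :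
    Integrable (fun x => F x * (β x : ℂ) ^ n) μ := by
  refine hF.mul_bdd (c := 1) ?_ (.of_forall fun x => by rw [norm_zpow, Circle.norm_coe, one_zpow])
  have : Continuous fun x => (β x : ℂ) ^ n :=
    Continuous.zpow₀ (by fun_prop) n fun x => .inl (Circle.coe_ne_zero _)
  exact this.measurable.aestronglyMeasurable

theorem continuous_of_mem_laurentSpan {q : Circle → ℂ} (hq : q ∈ laurentSpan) : Continuous q := by
  induction hq using Submodule.span_induction with
  | mem q hq =>
    obtain ⟨n, rfl⟩ := hq
    exact Continuous.zpow₀ (by fun_prop) n fun z => .inl (Circle.coe_ne_zero z)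
  | zero => exact continuous_const
  | add x y _ _ hx hy => exact hx.add hy
  | smul d x _ hx => exact hx.const_smul d

theorem integrable_mul_polynomial (hβ : Continuous β) (hF : Integrable F μ) (P : Polynomial ℂ) :
    Integrable (fun x => F x * P.eval (β x : ℂ)) μ := by
  induction P using Polynomial.induction_on' with
  | add p q hp hq =>
    simp only [Polynomial.eval_add, mul_add]
    exact hp.add hq
  | monomial n c =>
    simp only [Polynomial.eval_monomial, mul_left_comm _ c]
    exact_mod_cast (integrable_mul_zpow hβ hF n).const_mul c

/-- A function whose moments of positive order vanish sees a polynomial only through its value at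
`0`. -/
theorem integral_mul_polynomial (hβ : Continuous β) (hF : Integrable F μ)
    (hm : ∀ k : ℕ, 0 < k → ∫ x, F x * (β x : ℂ) ^ k ∂μ = 0) (P : Polynomial ℂ) :
    ∫ x, F x * P.eval (β x : ℂ) ∂μ = P.eval 0 * ∫ x, F x ∂μ := by
  induction P using Polynomial.induction_on' with
  | add p q hp hq =>
    simp only [Polynomial.eval_add, mul_add, add_mul]
    rw [integral_add (integrable_mul_polynomial hβ hF p) (integrable_mul_polynomial hβ hF q), hp, hq]
  | monomial n c =>
    simp only [Polynomial.eval_monomial, mul_left_comm _ c]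
    rw [integral_const_mul]
    rcases n.eq_zero_or_pos with rfl | hn
    · simp
    · simp [hm n hn, hn.ne']

theorem integral_mul_exp_polynomial (hβ : Continuous β) (hF : Integrable F μ)
    (hm : ∀ k : ℕ, 0 < k → ∫ x, F x * (β x : ℂ) ^ k ∂μ = 0) (P : Polynomial ℂ) :
    ∫ x, F x * Complex.exp (P.eval (β x : ℂ)) ∂μ = Complex.exp (P.eval 0) * ∫ x, F x ∂μ := by
  obtain ⟨B, hB⟩ : ∃ B : ℝ, ∀ z : Circle, ‖P.eval (z : ℂ)‖ ≤ B := by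
    have : Continuous fun z : Circle => P.eval (z : ℂ) := by fun_prop
    obtain ⟨B, hB⟩ := (isCompact_range this).isBounded.exists_norm_le
    exact ⟨B, fun z => hB _ ⟨z, rfl⟩⟩
  -- The partial sums of `exp ∘ P` are polynomials, uniformly bounded on the circle.
  let S (N : ℕ) : Polynomial ℂ := ∑ k ∈ Finset.range N, .C ((k.factorial : ℂ)⁻¹) * P ^ k
  have hS (w : ℂ) : Tendsto (fun N => (S N).eval w) atTop (𝓝 (Complex.exp (P.eval w))) := by
    have := (NormedSpace.exp_series_hasSum_exp' (𝕂 := ℂ) (P.eval w)).tendsto_sum_nat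
    simpa [S, Polynomial.eval_finsetSum, Complex.exp_eq_exp_ℂ] using this
  have hSb (N : ℕ) (z : Circle) : ‖(S N).eval (z : ℂ)‖ ≤ Real.exp B := by
    have hB0 : 0 ≤ B := (norm_nonneg _).trans (hB z)
    calc ‖(S N).eval (z : ℂ)‖ ≤ ∑ k ∈ Finset.range N, B ^ k / k.factorial := by
          simp only [S, Polynomial.eval_finsetSum]
          refine norm_sum_le_of_le _ fun k _ => ?_
          simp only [Polynomial.eval_mul, Polynomial.eval_C, Polynomial.eval_pow, norm_mul,
            norm_inv, norm_pow, div_eq_inv_mul, Complex.norm_natCast]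
          gcongr
          exact hB z
      _ ≤ Real.exp B := Real.sum_le_exp_of_nonneg hB0 N
  have h1 : Tendsto (fun N => ∫ x, F x * (S N).eval (β x : ℂ) ∂μ) atTop
      (𝓝 (∫ x, F x * Complex.exp (P.eval (β x : ℂ)) ∂μ)) := by
    refine tendsto_integral_of_dominated_convergence (fun x => ‖F x‖ * Real.exp B)
      (fun N => ?_) (hF.norm.mul_const _) (fun N => .of_forall fun x => ?_)
      (.of_forall fun x => (hS _).const_mul _)
    · refine hF.aestronglyMeasurable.mul ?_
      have : Continuous fun x => (S N).eval (β x : ℂ) := by fun_prop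
      exact this.measurable.aestronglyMeasurable
    · rw [norm_mul]
      gcongr
      exact hSb N _
  refine tendsto_nhds_unique h1 ?_
  simp only [integral_mul_polynomial hβ hF hm]
  exact (hS 0).mul_const _

/-- If the positive moments of `F` vanish and `F` is zero on `β ⁻¹' C`, a set charged by `σ`, then
the moment of order `0` vanishes too. Here `σ` is a measure that `β` maps to a multiple of Haar
measure. With polynomials `P` whose real part on the circle is close to the indicator of `C`, the
identity `∫ F exp (n P(β)) = exp (n P(0)) ∫ F` bounds `exp (n s) ‖∫ F‖` by `∫ ‖F‖` for every `n`,
where `s = σ (β ⁻¹' C) / σ univ > 0`. -/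
theorem integral_eq_zero_of_vanishing [IsFiniteMeasure σ] (hβ : Continuous β)
    (hσ : ∀ k : ℕ, 0 < k → ∫ x, (β x : ℂ) ^ k ∂σ = 0) (hF : Integrable F μ)
    (hm : ∀ k : ℕ, 0 < k → ∫ x, F x * (β x : ℂ) ^ k ∂μ = 0)
    {C : Set Circle} (hC : IsClosed C) (hσC : σ (β ⁻¹' C) ≠ 0)
    (hFC : ∀ᵐ x ∂μ, β x ∈ C → F x = 0) : ∫ x, F x ∂μ = 0 := by
  obtain ⟨q, hq, hqb, hqt⟩ := exists_laurent_tendsto_indicator hC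
  choose P hP using fun j => exists_polynomial_re_eq (hq j)
  have hqc (j : ℕ) : Measurable fun x => (q j (β x)).re :=
    (Complex.continuous_re.comp ((continuous_of_mem_laurentSpan (hq j)).comp hβ)).measurable
  have hqre (j : ℕ) (z : Circle) : ‖(q j z).re‖ ≤ 2 := (Complex.abs_re_le_norm _).trans (hqb j z)
  set M : ℝ := σ.real univ
  set m : ℝ := σ.real (β ⁻¹' C)
  have hm0 : 0 < m := by
    exact ENNReal.toReal_pos hσC (measure_ne_top _ _)
  have hM0 : 0 < M := hm0.trans_le (measureReal_mono (subset_univ _))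
  -- `P j` takes at `0` the `σ`-mean of its values on the circle.
  have hmean (j : ℕ) : ((P j).eval 0).re * M = ∫ x, (q j (β x)).re ∂σ := by
    have h := integral_mul_polynomial (F := fun _ => (1 : ℂ)) hβ (integrable_const (μ := σ) _)
      (by simpa using hσ) (P j)
    simp only [one_mul, integral_const] at h
    have hi : Integrable (fun x => (P j).eval (β x : ℂ)) σ := by
      simpa using integrable_mul_polynomial (F := fun _ => (1 : ℂ)) hβ (integrable_const (μ := σ) _)
        (P j)
    simp only [← hP]
    rw [← RCLike.re_eq_complex_re, integral_re hi, h]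
    simp [M]
  have hlim1 : Tendsto (fun j => ((P j).eval 0).re) atTop (𝓝 (m / M)) := by
    have : Tendsto (fun j => ∫ x, (q j (β x)).re ∂σ) atTop
        (𝓝 (∫ x, (β ⁻¹' C).indicator 1 x ∂σ)) := by
      refine tendsto_integral_of_dominated_convergence (fun _ => 2)
        (fun j => (hqc j).aestronglyMeasurable) (integrable_const _)
        (fun j => .of_forall fun x => hqre j _) (.of_forall fun x => ?_)
      convert! (Complex.continuous_re.tendsto _).comp (hqt (β x)) using 2
      by_cases hx : β x ∈ C <;> simp [hx]
    rw [integral_indicator_one (hC.preimage hβ).measurableSet] at this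
    refine (this.div_const M).congr fun j => ?_
    rw [← hmean, mul_div_cancel_right₀ _ hM0.ne']
  have hkey (n : ℕ) : Real.exp (n * (m / M)) * ‖∫ x, F x ∂μ‖ ≤ ∫ x, ‖F x‖ ∂μ := by
    have hl : Tendsto (fun j => Real.exp (n * ((P j).eval 0).re) * ‖∫ x, F x ∂μ‖) atTop
        (𝓝 (Real.exp (n * (m / M)) * ‖∫ x, F x ∂μ‖)) :=
      ((Real.continuous_exp.tendsto _).comp (hlim1.const_mul _)).mul_const _
    -- The limit of the weight `exp (n Re q)` is `1` off `C`, and on `C` the function `F` is zero.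
    have hr : Tendsto (fun j => ∫ x, ‖F x‖ * Real.exp (n * (q j (β x)).re) ∂μ) atTop
        (𝓝 (∫ x, ‖F x‖ ∂μ)) := by
      refine tendsto_integral_of_dominated_convergence (fun x => ‖F x‖ * Real.exp (n * 2))
        (fun j => hF.norm.aestronglyMeasurable.mul
          (Real.measurable_exp.comp ((hqc j).const_mul _)).aestronglyMeasurable)
        (hF.norm.mul_const _) (fun j => .of_forall fun x => ?_) ?_
      · rw [norm_mul, norm_norm, Real.norm_eq_abs, Real.abs_exp]
        gcongr
        exact (le_abs_self _).trans (hqre j _)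
      · filter_upwards [hFC] with x hx
        by_cases h : β x ∈ C
        · simp [hx h]
        · have h1 := (Complex.continuous_re.tendsto _).comp (hqt (β x))
          have h2 := ((Real.continuous_exp.tendsto _).comp (h1.const_mul (n : ℝ))).const_mul ‖F x‖
          simpa [h] using h2
    refine le_of_tendsto_of_tendsto' hl hr fun j => ?_
    have h := integral_mul_exp_polynomial hβ hF hm ((n : Polynomial ℂ) * P j)
    have h2 := congrArg norm h
    rw [norm_mul, Complex.norm_exp] at h2
    simp only [Polynomial.eval_mul, Polynomial.eval_natCast] at h2
    have e (w : ℂ) : ((n : ℂ) * w).re = n * w.re := by simp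
    rw [e] at h2
    rw [← h2]
    refine (norm_integral_le_integral_norm _).trans_eq ?_
    congr 1 with x
    rw [norm_mul, Complex.norm_exp, e, hP]
  by_contra hne
  have hpos : 0 < ‖∫ x, F x ∂μ‖ := norm_pos_iff.2 hne
  have ht : Tendsto (fun n : ℕ => Real.exp (n * (m / M)) * ‖∫ x, F x ∂μ‖) atTop atTop :=
    (Real.tendsto_exp_atTop.comp
      (tendsto_natCast_atTop_atTop.atTop_mul_const (div_pos hm0 hM0))).atTop_mul_const hpos
  obtain ⟨n, hn⟩ := (ht.eventually_gt_atTop (∫ x, ‖F x‖ ∂μ)).exists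
  exact absurd (hkey n) (not_le.2 hn)

/-- The theorem of F. and M. Riesz in the form that is needed: vanishing of the moments of
nonnegative order propagates to those of negative order, by applying `integral_eq_zero_of_vanishing`
to `F β⁻ⁿ`. -/
theorem integral_mul_zpow_eq_zero_of_vanishing [IsFiniteMeasure σ] (hβ : Continuous β)
    (hσ : ∀ k : ℕ, 0 < k → ∫ x, (β x : ℂ) ^ k ∂σ = 0) (hF : Integrable F μ)
    (hm : ∀ k : ℕ, ∫ x, F x * (β x : ℂ) ^ k ∂μ = 0)
    {C : Set Circle} (hC : IsClosed C) (hσC : σ (β ⁻¹' C) ≠ 0)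
    (hFC : ∀ᵐ x ∂μ, β x ∈ C → F x = 0) (n : ℤ) : ∫ x, F x * (β x : ℂ) ^ n ∂μ = 0 := by
  have hneg (N : ℕ) : ∀ n : ℤ, -N ≤ n → ∫ x, F x * (β x : ℂ) ^ n ∂μ = 0 := by
    induction N with
    | zero =>
      intro n hn
      lift n to ℕ using (by simpa using hn)
      exact_mod_cast hm n
    | succ N ih =>
      intro n hn
      rcases hn.eq_or_lt with rfl | hlt
      · refine integral_eq_zero_of_vanishing hβ hσ (integrable_mul_zpow hβ hF _) (fun k hk => ?_) hC hσC
          (hFC.mono fun x hx h => by simp [hx h])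
        rw [← ih (-(N + 1 : ℕ) + k) (by push_cast; omega)]
        congr 1 with x
        rw [mul_assoc, zpow_add₀ (Circle.coe_ne_zero _), zpow_natCast]
      · exact ih n (by push_cast at hlt; omega)
  exact hneg n.natAbs n (by omega)

theorem setIntegral_preimage_eq_zero (hβ : Continuous β) (hF : Integrable F μ)
    (hm : ∀ n : ℤ, ∫ x, F x * (β x : ℂ) ^ n ∂μ = 0) {C : Set Circle} (hC : IsClosed C) :
    ∫ x in β ⁻¹' C, F x ∂μ = 0 := by
  obtain ⟨q, hq, hqb, hqt⟩ := exists_laurent_tendsto_indicator hC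
  have hz {q : Circle → ℂ} (hq : q ∈ laurentSpan) :
      Integrable (fun x => F x * q (β x)) μ ∧ ∫ x, F x * q (β x) ∂μ = 0 := by
    induction hq using Submodule.span_induction with
    | mem q hq =>
      obtain ⟨n, rfl⟩ := hq
      exact ⟨integrable_mul_zpow hβ hF n, hm n⟩
    | zero => simp
    | add x y _ _ hx hy =>
      simp only [Pi.add_apply, mul_add]
      exact ⟨hx.1.add hy.1, by rw [integral_add hx.1 hy.1, hx.2, hy.2, add_zero]⟩
    | smul d x _ hx =>
      simp only [Pi.smul_apply, smul_eq_mul, mul_left_comm _ d]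
      exact ⟨hx.1.const_mul d, by rw [integral_const_mul, hx.2, mul_zero]⟩
  have ht : Tendsto (fun j => ∫ x, F x * q j (β x) ∂μ) atTop
      (𝓝 (∫ x, (β ⁻¹' C).indicator F x ∂μ)) := by
    refine tendsto_integral_of_dominated_convergence (fun x => ‖F x‖ * 2)
      (fun j => (hz (hq j)).1.aestronglyMeasurable) (hF.norm.mul_const _)
      (fun j => .of_forall fun x => ?_) (.of_forall fun x => ?_)
    · rw [norm_mul]
      gcongr
      exact hqb j _
    · convert! (hqt (β x)).const_mul (F x) using 2
      by_cases h : β x ∈ C <;> simp [h]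
  rw [integral_indicator (hC.preimage hβ).measurableSet] at ht
  refine tendsto_nhds_unique ht ?_
  simp [fun j => (hz (hq j)).2]

end Moments

/-! ### The Cayley map and the Hardy space of a half-plane -/

/-- The Cayley map `ξ ↦ (1 + i c ξ) / (1 - i c ξ)` from the line to the unit circle. -/
noncomputable def cayley (c ξ : ℝ) : Circle :=
  Circle.ofConjDivSelf (1 - ((c * ξ : ℝ) : ℂ) * Complex.I) (one_sub_mul_I_ne_zero _)

/-- The kernel `1 / (1 - i c ξ)`. -/
noncomputable def cauchyKernel (c ξ : ℝ) : ℂ := 1 / (1 - ((c * ξ : ℝ) : ℂ) * Complex.I)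

theorem coe_cayley (c ξ : ℝ) : (cayley c ξ : ℂ) = 2 * cauchyKernel c ξ - 1 := by
  have h := one_sub_mul_I_ne_zero (c * ξ)
  simp only [cayley, cauchyKernel, Circle.ofConjDivSelf_coe]
  field_simp
  simp
  ring

theorem continuous_cauchyKernel (c : ℝ) : Continuous (cauchyKernel c) :=
  Continuous.div (by fun_prop) (by fun_prop) fun _ => one_sub_mul_I_ne_zero _

theorem continuous_cayley (c : ℝ) : Continuous (cayley c) := by
  refine continuous_induced_rng.2 ?_
  have : ((↑) : Circle → ℂ) ∘ cayley c = fun ξ => 2 * cauchyKernel c ξ - 1 :=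
    funext (coe_cayley c)
  exact this ▸ ((continuous_cauchyKernel c).const_mul 2).sub continuous_const

theorem cayley_injective {c : ℝ} (hc : c ≠ 0) : Function.Injective (cayley c) := by
  intro x y h
  have h1 := congrArg ((↑) : Circle → ℂ) h
  rw [coe_cayley, coe_cayley, sub_left_inj, mul_right_inj' two_ne_zero, cauchyKernel, cauchyKernel,
    one_div, one_div, inv_inj, sub_right_inj] at h1
  simpa [hc] using h1

theorem norm_cauchyKernel_sq (c ξ : ℝ) : ‖cauchyKernel c ξ‖ ^ 2 = (1 + (c * ξ) ^ 2)⁻¹ := by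
  rw [cauchyKernel, norm_div, norm_one, one_div, inv_pow, Complex.sq_norm, Complex.normSq_apply]
  simp
  ring

theorem norm_cauchyKernel_le_one (c ξ : ℝ) : ‖cauchyKernel c ξ‖ ≤ 1 := by
  rw [← sq_le_one_iff₀ (norm_nonneg _), norm_cauchyKernel_sq]
  exact inv_le_one_of_one_le₀ (by nlinarith [sq_nonneg (c * ξ)])

theorem integrable_inv_one_add_mul_sq {c : ℝ} (hc : c ≠ 0) :
    Integrable fun ξ : ℝ => (1 + (c * ξ) ^ 2)⁻¹ :=
  integrable_inv_one_add_sq.comp_mul_left' hc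

theorem memLp_cauchyKernel {c : ℝ} (hc : c ≠ 0) : MemLp (cauchyKernel c) 2 := by
  rw [memLp_two_iff_integrable_sq_norm (continuous_cauchyKernel c).aestronglyMeasurable]
  simpa only [norm_cauchyKernel_sq] using integrable_inv_one_add_mul_sq hc

theorem hasDerivAt_cauchyKernel (c ξ : ℝ) :
    HasDerivAt (cauchyKernel c) (c * Complex.I * cauchyKernel c ξ ^ 2) ξ := by
  have h := one_sub_mul_I_ne_zero (c * ξ)
  have h1 : HasDerivAt (fun ξ : ℝ => 1 - ((c * ξ : ℝ) : ℂ) * Complex.I) (-(c * Complex.I)) ξ := by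
    simpa using ((((hasDerivAt_id ξ).const_mul c).ofReal_comp).mul_const Complex.I).const_sub 1
  have h2 := h1.inv h
  convert! h2 using 1
  · ext x
    simp [cauchyKernel]
  · rw [cauchyKernel]
    field_simp

theorem tendsto_cauchyKernel {c : ℝ} (hc : c ≠ 0) :
    Tendsto (cauchyKernel c) (cocompact ℝ) (𝓝 0) := by
  rw [← Metric.cobounded_eq_cocompact]
  refine squeeze_zero_norm' (a := fun ξ => |c|⁻¹ * ‖ξ⁻¹‖) ?_ ?_
  · filter_upwards [Bornology.isBounded_def.1 (Bornology.isBounded_singleton (x := (0 : ℝ)))] with ξ hξ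
    have hξ : ξ ≠ 0 := hξ
    rw [cauchyKernel, one_div, norm_inv, norm_inv, ← mul_inv, Real.norm_eq_abs, ← abs_mul]
    refine inv_anti₀ (abs_pos.2 (mul_ne_zero hc hξ)) ?_
    simpa using Complex.abs_im_le_norm (1 - ((c * ξ : ℝ) : ℂ) * Complex.I)
  · simpa using (tendsto_inv₀_cobounded.norm.const_mul |c|⁻¹ : Tendsto (fun ξ : ℝ => |c|⁻¹ * ‖ξ⁻¹‖) _ _)

/-- The Cayley map sends the density `1 / (1 + (c ξ)²)` to a multiple of Haar measure: its moments
of positive order vanish, because the integrand is the derivative of a multiple of `cayley c ξ ^ k`,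
which has the same limit at both ends of the line. -/
theorem integral_inv_mul_cayley_pow {c : ℝ} (hc : c ≠ 0) {k : ℕ} (hk : 0 < k) :
    ∫ ξ, ((1 + (c * ξ) ^ 2)⁻¹ : ℝ) • (cayley c ξ : ℂ) ^ k = 0 := by
  have hd (ξ : ℝ) : HasDerivAt (fun ξ => (2 * cauchyKernel c ξ - 1) ^ k / (2 * c * Complex.I * k))
      (((1 + (c * ξ) ^ 2)⁻¹ : ℝ) • (cayley c ξ : ℂ) ^ k) ξ := by
    have h1 := ((((hasDerivAt_cauchyKernel c ξ).const_mul 2).sub_const 1).pow k).div_const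
      (2 * c * Complex.I * k)
    convert! h1 using 1
    have hk0 : (k : ℂ) ≠ 0 := by exact_mod_cast hk.ne'
    have hc0 : (c : ℂ) ≠ 0 := by exact_mod_cast hc
    -- `1 + (cξ)² = (1 - icξ)(1 + icξ)`, and the second factor cancels in the Cayley map.
    have e : (((1 + (c * ξ) ^ 2)⁻¹ : ℝ) : ℂ) * (2 * cauchyKernel c ξ - 1) = cauchyKernel c ξ ^ 2 := by
      have h := one_sub_mul_I_ne_zero (c * ξ)
      have h' : (1 + ((c * ξ : ℝ) : ℂ) * Complex.I) ≠ 0 := by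
        simpa using one_sub_mul_I_ne_zero (-(c * ξ))
      have h2 : (1 + ((c * ξ : ℝ) : ℂ) ^ 2) =
          (1 - ((c * ξ : ℝ) : ℂ) * Complex.I) * (1 + ((c * ξ : ℝ) : ℂ) * Complex.I) := by
        push_cast
        linear_combination ((c : ℂ) * ξ) ^ 2 * Complex.I_sq
      rw [cauchyKernel]
      push_cast at *
      rw [h2]
      field_simp
      ring
    obtain ⟨j, rfl⟩ : ∃ j, k = j + 1 := ⟨k - 1, by omega⟩
    rw [coe_cayley, Complex.real_smul, pow_succ (2 * cauchyKernel c ξ - 1), mul_left_comm, e,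
      Nat.add_sub_cancel]
    field_simp
  have hi : Integrable fun ξ => ((1 + (c * ξ) ^ 2)⁻¹ : ℝ) • (cayley c ξ : ℂ) ^ k := by
    have h1 := integrable_mul_zpow (continuous_cayley c) (integrable_inv_one_add_mul_sq hc).ofReal k
    simpa using h1
  have ht : Tendsto (fun ξ => (2 * cauchyKernel c ξ - 1) ^ k / (2 * c * Complex.I * k))
      (cocompact ℝ) (𝓝 ((2 * 0 - 1) ^ k / (2 * c * Complex.I * k))) :=
    ((((tendsto_cauchyKernel hc).const_mul 2).sub_const 1).pow k).div_const _
  rw [integral_of_hasDerivAt_of_tendsto hd hi (ht.mono_left atBot_le_cocompact)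
    (ht.mono_left atTop_le_cocompact), sub_self]

/-- A function of the Hardy space `H²` of a half-plane, described by the vanishing of its moments
against the powers of the Cauchy kernel, is zero if it vanishes on a set of positive measure. -/
theorem ae_eq_zero_of_moments {Z : ℝ → ℂ} (hZ : MemLp Z 2) {c : ℝ} (hc : c ≠ 0)
    (hm : ∀ n : ℕ, ∫ ξ, Z ξ * cauchyKernel c ξ ^ (n + 1) = 0) {E : Set ℝ} (hE : MeasurableSet E)
    (hE0 : volume E ≠ 0) (hZE : ∀ᵐ ξ : ℝ, ξ ∈ E → Z ξ = 0) : Z =ᵐ[volume] 0 := by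
  have hF : Integrable (fun ξ => Z ξ * cauchyKernel c ξ) := hZ.integrable_mul (memLp_cauchyKernel hc)
  have hmF (k : ℕ) : ∫ ξ, Z ξ * cauchyKernel c ξ * (cayley c ξ : ℂ) ^ k = 0 := by
    have h (Q : Polynomial ℂ) : Integrable (fun ξ => Z ξ * cauchyKernel c ξ *
          Q.eval (cauchyKernel c ξ)) ∧
        ∫ ξ, Z ξ * cauchyKernel c ξ * Q.eval (cauchyKernel c ξ) = 0 := by
      induction Q using Polynomial.induction_on' with
      | add p q hp hq =>
        simp only [Polynomial.eval_add, mul_add]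
        exact ⟨hp.1.add hq.1, by rw [integral_add hp.1 hq.1, hp.2, hq.2, add_zero]⟩
      | monomial n a =>
        simp only [Polynomial.eval_monomial, mul_left_comm _ a]
        have h1 : Integrable fun ξ => Z ξ * cauchyKernel c ξ * cauchyKernel c ξ ^ n :=
          hF.mul_bdd (c := 1) ((continuous_cauchyKernel c).pow n).aestronglyMeasurable
            (.of_forall fun ξ => by
              rw [norm_pow]
              exact pow_le_one₀ (norm_nonneg _) (norm_cauchyKernel_le_one c ξ))
        refine ⟨h1.const_mul a, ?_⟩
        simp only [integral_const_mul, mul_assoc, ← pow_succ', hm n, mul_zero]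
    have h2 := (h ((2 * .X - 1) ^ k)).2
    simpa [coe_cayley] using h2
  -- The zero set is replaced by a compact one, whose image in the circle is closed.
  obtain ⟨K, hKE, hK, hK0⟩ := hE.exists_lt_isCompact (pos_iff_ne_zero.2 hE0)
  let w (ξ : ℝ) : ENNReal := ENNReal.ofReal (1 + (c * ξ) ^ 2)⁻¹
  have hw : Measurable w := by fun_prop
  let σ : Measure ℝ := volume.withDensity w
  have : IsFiniteMeasure σ := isFiniteMeasure_withDensity_ofReal (integrable_inv_one_add_mul_sq hc).2
  have hσ (k : ℕ) (hk : 0 < k) : ∫ ξ, (cayley c ξ : ℂ) ^ k ∂σ = 0 := by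
    rw [integral_withDensity_eq_integral_toReal_smul hw (.of_forall fun _ => ENNReal.ofReal_lt_top),
      ← integral_inv_mul_cayley_pow hc hk]
    congr 1 with ξ
    rw [ENNReal.toReal_ofReal (by positivity)]
  have hpre {K : Set ℝ} : cayley c ⁻¹' (cayley c '' K) = K :=
    preimage_image_eq _ (cayley_injective hc)
  have hclosed {K : Set ℝ} (hK : IsCompact K) : IsClosed (cayley c '' K) :=
    (hK.image (continuous_cayley c)).isClosed
  have hσK : σ (cayley c ⁻¹' (cayley c '' K)) ≠ 0 := by
    rw [hpre]
    intro h
    refine hK0.ne' (withDensity_absolutelyContinuous' hw.aemeasurable (.of_forall fun ξ => ?_) h)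
    have : 0 < (1 + (c * ξ) ^ 2)⁻¹ := by positivity
    simpa [w] using this
  have hall := integral_mul_zpow_eq_zero_of_vanishing (continuous_cayley c) hσ hF hmF (hclosed hK)
    hσK (hZE.mono fun ξ h hξ => by
      rw [← mem_preimage, hpre] at hξ
      rw [h (hKE hξ), zero_mul])
  have hF0 : (fun ξ => Z ξ * cauchyKernel c ξ) =ᵐ[volume] 0 := by
    refine ae_eq_zero_of_forall_setIntegral_isCompact_eq_zero' hF.locallyIntegrable fun L hL => ?_
    have := setIntegral_preimage_eq_zero (continuous_cayley c) hF hall (hclosed hL)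
    rwa [hpre] at this
  filter_upwards [hF0] with ξ hξ
  exact (mul_eq_zero.1 hξ).resolve_right (one_div_ne_zero (one_sub_mul_I_ne_zero _))

/-! ### Uniqueness for branched processes -/

theorem ae_eq_zero_of_phase_moments {Z : L2} {ε a κ : ℝ} (hε : |ε| = 1) (hκ : κ ≠ 0)
    (hm : ∀ n : ℕ, ∫ ξ, Z ξ * Complex.exp (((-(κ * ξ) : ℝ) : ℂ) * a * Complex.I) *
      (1 / (1 - ((-(ε * κ) * ξ : ℝ) : ℂ) * Complex.I)) ^ (n + 1) = 0)
    {E : Set ℝ} (hE : MeasurableSet E) (hE0 : volume E ≠ 0)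
    (hZE : ∀ᵐ ξ : ℝ, ξ ∈ E → Z ξ = 0) : Z = 0 := by
  have hε0 : ε ≠ 0 := by
    rintro rfl
    simp at hε
  have hph : Continuous fun ξ : ℝ => Complex.exp (((-(κ * ξ) : ℝ) : ℂ) * a * Complex.I) := by
    fun_prop
  have hmem : MemLp (fun ξ => Z ξ * Complex.exp (((-(κ * ξ) : ℝ) : ℂ) * a * Complex.I)) 2 := by
    refine (Lp.memLp Z).of_le ((Lp.aestronglyMeasurable Z).mul hph.aestronglyMeasurable)
      (.of_forall fun ξ => ?_)
    rw [norm_mul, ← Complex.ofReal_mul, Complex.norm_exp_ofReal_mul_I, mul_one]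
  have h := ae_eq_zero_of_moments hmem (neg_ne_zero.2 (mul_ne_zero hε0 hκ)) hm hE hE0
    (hZE.mono fun ξ h hξ => by rw [h hξ, zero_mul])
  rw [Lp.eq_zero_iff_ae_eq_zero]
  filter_upwards [h] with ξ hξ
  exact (mul_eq_zero.1 hξ).resolve_right (Complex.exp_ne_zero _)

theorem eq_zero_of_fourier_vanishing {z : L2} {ε a : ℝ} (hε : |ε| = 1)
    (hz : ∀ᵐ t : ℝ, 0 < ε * (t - a) → z t = 0) {E : Set ℝ} (hE : MeasurableSet E)
    (hE0 : volume E ≠ 0) (hZE : ∀ᵐ ξ : ℝ, ξ ∈ E → (𝓕 z : L2) ξ = 0) : z = 0 := by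
  have h := ae_eq_zero_of_phase_moments hε (neg_ne_zero.2 (by positivity)) (fourier_moments hε hz)
    hE hE0 hZE
  exact (Lp.fourierTransformₗᵢ ℝ ℂ).map_eq_zero_iff.1 h

theorem eq_zero_of_fourierInv_vanishing {Z : L2} {ε a : ℝ} (hε : |ε| = 1)
    (hZ : ∀ᵐ ξ : ℝ, 0 < ε * (ξ - a) → Z ξ = 0) {E : Set ℝ} (hE : MeasurableSet E)
    (hE0 : volume E ≠ 0) (hzE : ∀ᵐ t : ℝ, t ∈ E → (𝓕⁻ Z : L2) t = 0) : Z = 0 := by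
  have h := ae_eq_zero_of_phase_moments hε (by positivity) (fourierInv_moments hε hZ) hE hE0 hzE
  exact (Lp.fourierTransformₗᵢ ℝ ℂ).symm.map_eq_zero_iff.1 h

theorem volume_eq_top_of_mem_IInf {B : Set ℝ} (hB : B ∈ IInf) : volume B = ⊤ := by
  obtain ⟨-, a, h | h⟩ := hB <;> exact measure_mono_top h (by simp)

theorem measurableSet_of_mem_IAll {B : Set ℝ} (hB : B ∈ IAll) : MeasurableSet B :=
  hB.elim (·.1) (·.1)

theorem volume_ne_zero_of_mem_IAll {B : Set ℝ} (hB : B ∈ IAll) : volume B ≠ 0 :=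
  hB.elim (·.2.1.ne') fun h => by simp [volume_eq_top_of_mem_IInf h]

theorem mem_IInf_of_volume_eq_top {B : Set ℝ} (hB : B ∈ IAll) (h : volume B = ⊤) : B ∈ IInf :=
  hB.resolve_left fun hf => hf.2.2.ne h

theorem exists_half_line {B : Set ℝ} (hB : B ∈ IInf) :
    ∃ ε a : ℝ, |ε| = 1 ∧ ∀ t, 0 < ε * (t - a) → t ∈ B := by
  obtain ⟨-, a, h | h⟩ := hB
  · exact ⟨1, a, by simp, fun t ht => h (by simpa using ht)⟩
  · exact ⟨-1, a, by simp, fun t ht => h (by simpa using ht)⟩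

theorem ae_fourier_eq_zero {x : L2} {G : Set ℝ} (h : ∀ᵐ ω : ℝ, ω ∈ G → angFourier x ω = 0) :
    ∀ᵐ ξ : ℝ, ξ ∈ (2 * Real.pi * ·) ⁻¹' G → (𝓕 x : L2) ξ = 0 := by
  have hpi : 2 * Real.pi ≠ 0 := by positivity
  have hq : Measure.QuasiMeasurePreserving (2 * Real.pi * ·) (volume : Measure ℝ) volume := by
    refine ⟨by fun_prop, ?_⟩
    rw [Real.map_volume_mul_left hpi]
    exact Measure.smul_absolutelyContinuous
  filter_upwards [hq.ae h] with ξ hξ hG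
  have := hξ hG
  rwa [angFourier, mul_div_cancel_left₀ _ hpi] at this

/-- Two elements of `L₂` agree if they agree on `I` and both spectra vanish on `G`, for `I, G ∈ 𝓘`
of which at least one contains a half-line. The difference is one-sided in time in the first case
and in frequency in the second. -/
theorem eq_of_eq_on_of_angFourier_eq_zero {I G : Set ℝ} (hI : I ∈ IAll) (hG : G ∈ IAll)
    (hIG : volume (I ∪ G) = ⊤) {x y : L2} (hxy : ∀ᵐ t : ℝ, t ∈ I → x t = y t)
    (hx : ∀ᵐ ω : ℝ, ω ∈ G → angFourier x ω = 0) (hy : ∀ᵐ ω : ℝ, ω ∈ G → angFourier y ω = 0) :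
    x = y := by
  have hpi : 0 < 2 * Real.pi := by positivity
  set G' : Set ℝ := (2 * Real.pi * ·) ⁻¹' G
  have hGm : MeasurableSet G' :=
    (measurableSet_of_mem_IAll hG).preimage (by fun_prop)
  have hG0 : volume G' ≠ 0 := by
    rw [Real.volume_preimage_mul_left hpi.ne']
    refine mul_ne_zero ?_ (volume_ne_zero_of_mem_IAll hG)
    simp [Real.pi_ne_zero]
  have hz : ∀ᵐ t : ℝ, t ∈ I → (x - y : L2) t = 0 := by
    filter_upwards [hxy, Lp.coeFn_sub x y] with t h1 h2 ht
    rw [h2, Pi.sub_apply, h1 ht, sub_self]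
  have hF : (𝓕 (x - y) : L2) = 𝓕 x - 𝓕 y := (Lp.fourierTransformₗᵢ ℝ ℂ).map_sub x y
  have hZ : ∀ᵐ ξ : ℝ, ξ ∈ G' → (𝓕 (x - y) : L2) ξ = 0 := by
    rw [hF]
    filter_upwards [ae_fourier_eq_zero hx, ae_fourier_eq_zero hy, Lp.coeFn_sub (𝓕 x : L2) (𝓕 y)]
      with ξ h1 h2 h3 hξ
    rw [h3, Pi.sub_apply, h1 hξ, h2 hξ, sub_self]
  refine sub_eq_zero.1 ?_
  rcases measure_union_eq_top_iff.1 hIG with h | h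
  · obtain ⟨ε, a, hε, ha⟩ := exists_half_line (mem_IInf_of_volume_eq_top hI h)
    exact eq_zero_of_fourier_vanishing hε (hz.mono fun t ht h => ht (ha t h)) hGm hG0 hZ
  · obtain ⟨ε, a, hε, ha⟩ := exists_half_line (mem_IInf_of_volume_eq_top hG h)
    have h0 : (𝓕 (x - y) : L2) = 0 := by
      refine eq_zero_of_fourierInv_vanishing (a := a / (2 * Real.pi)) hε
        (hZ.mono fun ξ hξ h => hξ (ha _ ?_)) (measurableSet_of_mem_IAll hI)
        (volume_ne_zero_of_mem_IAll hI) ?_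
      · have := mul_pos hpi h
        have e : 2 * Real.pi * (ε * (ξ - a / (2 * Real.pi))) = ε * (2 * Real.pi * ξ - a) := by
          field_simp
        rwa [e] at this
      · rwa [FourierTransform.fourierInv_fourier_eq]
    exact (Lp.fourierTransformₗᵢ ℝ ℂ).map_eq_zero_iff.1 h0

/-- Equality on the first branch propagates along the chains. -/
theorem eq_of_first_branch_eq {m : ℕ} [NeZero m] (T : Triplet m) (G : Fin m → Set ℝ)
    (hG : ∀ d : Fin m, d ≠ 0 → G d ∈ IAll) (hreach : ∀ d : Fin m, d ≠ 0 → T.Reaches G 0 d)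
    {x y : Fin m → L2} (hx : x ∈ T.gapProcesses G) (hy : y ∈ T.gapProcesses G)
    (h0 : x 0 = y 0) : x = y := by
  funext d
  by_cases hd : d = 0
  · rw [hd, h0]
  obtain ⟨j, c, hc0, hcd, hstep⟩ := hreach d hd
  suffices ∀ k ≤ j + 1, x (c k) = y (c k) from hcd ▸ this (j + 1) le_rfl
  intro k
  induction k with
  | zero => exact fun _ => hc0 ▸ h0
  | succ k ih =>
    intro hk
    -- a chain may return to the first branch, where `G 0` may be empty
    by_cases hck : c (k + 1) = 0
    · rw [hck, h0]
    obtain ⟨e, he⟩ := hstep (k + 1) (by simpa using hk)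
    refine eq_of_eq_on_of_angFourier_eq_zero (T.I_mem _) (hG _ hck) he ?_ (hx.2 _) (hy.2 _)
    have hprev : x (c (k + 1 - 1)) = y (c (k + 1 - 1)) := ih (by omega)
    filter_upwards [hx.1 _ _ e, hy.1 _ _ e] with t h1 h2 ht
    rw [h1 ht, h2 ht, hprev]

end HardyUniqueness

/-- Branches `1, …, m` are the indices `0, …, m - 1` of `Fin m`; the first branch is `0 : Fin m`. -/
theorem lemma3p1 (m : ℕ) [NeZero m] (T : Branched.Triplet m) (G : Fin m → Set ℝ)
    (hG₁ : G 0 = ∅ ∨ G 0 ∈ Branched.IAll)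
    (hG : ∀ d : Fin m, d ≠ 0 → G d ∈ Branched.IAll)
    (hreach : ∀ d : Fin m, d ≠ 0 → T.Reaches G 0 d) :
    (∀ x ∈ T.gapProcesses G, ∀ y ∈ T.gapProcesses G, x 0 = y 0 → x = y) ∧
    (G 0 ∈ Branched.IAll → ∀ J ∈ Branched.IInf,
      ∀ x ∈ T.gapProcesses G, ∀ y ∈ T.gapProcesses G,
        (∀ᵐ t : ℝ, t ∈ J → (x 0) t = (y 0) t) → x = y) ∧
    (G 0 ∈ Branched.IInf → ∀ J ∈ Branched.IAll,
      ∀ x ∈ T.gapProcesses G, ∀ y ∈ T.gapProcesses G,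
        (∀ᵐ t : ℝ, t ∈ J → (x 0) t = (y 0) t) → x = y) := by
  refine ⟨fun x hx y hy h => HardyUniqueness.eq_of_first_branch_eq T G hG hreach hx hy h,
    fun hG0 J hJ x hx y hy h => ?_, fun hG0 J hJ x hx y hy h => ?_⟩
  · refine HardyUniqueness.eq_of_first_branch_eq T G hG hreach hx hy
      (HardyUniqueness.eq_of_eq_on_of_angFourier_eq_zero (.inr hJ) hG0 ?_ h (hx.2 0) (hy.2 0))
    exact measure_mono_top subset_union_left (HardyUniqueness.volume_eq_top_of_mem_IInf hJ)
  · refine HardyUniqueness.eq_of_first_branch_eq T G hG hreach hx hy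
      (HardyUniqueness.eq_of_eq_on_of_angFourier_eq_zero hJ (.inr hG0) ?_ h (hx.2 0) (hy.2 0))
    exact measure_mono_top subset_union_right (HardyUniqueness.volume_eq_top_of_mem_IInf hG0)
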